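/- Let $p$ be a prime and let $G$ be a finite non-cyclic group of order at most $p^p$ and of exponent $p$. Then every Sylow $p$-subgroup of $\operatorname{Aut}(G)$ has exponent exactly $p$. Moreover, Berkovich's Problem 1891 has a negative answer: there do not exist a prime $p$ and a group $G$ of order $p^p$ and exponent $p$ such that $p^2$ divides $\exp(\operatorname{Aut}(G))$. -/

import Mathlib

universe u

open scoped commutatorElement

/-! An automorphism `α` of `p`-power order makes `H = G ⋊ ⟨α⟩` a finite `p`-group in which `N = G`
is normal of exponent `p` and order at most `p ^ p`; the claim `α ^ p = 1` says that `a ^ p`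
centralizes `N`, where `a` is the copy of `α` in `H`. Put `M = [N, H]`. Since `x a x⁻¹ = [x, a] a`
with `[x, a] ∈ M`, it suffices that `(y a) ^ p = a ^ p` for `y ∈ M`. The order bound gives `M⟨a⟩`
class less than `p`, and there the sequence `n ↦ (y a) ^ n a ^ (-n)` is polynomial: its Taylor
coefficients of degree `0 < k < p` lie in `M` and are killed by `p ∣ p.choose k`, while the degree
`p` term is trivial by the class (`apply_prime_eq_one`).

Exponent `1` is excluded by an automorphism of order `p`: inner if `G` is nonabelian, a transvection
otherwise. -/

/-! ### Commutators in the lower central series -/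

/-- The three subgroups lemma relative to a normal subgroup. -/
theorem commutator_commutator_le_of_rotate {G : Type*} [Group G] {A B C N : Subgroup G} [N.Normal]
    (h1 : ⁅⁅B, C⁆, A⁆ ≤ N) (h2 : ⁅⁅C, A⁆, B⁆ ≤ N) : ⁅⁅A, B⁆, C⁆ ≤ N := by
  have key : ∀ D : Subgroup G, D.map (QuotientGroup.mk' N) = ⊥ ↔ D ≤ N := fun D => by
    rw [Subgroup.map_eq_bot_iff, QuotientGroup.ker_mk']
  rw [← key] at h1 h2 ⊢
  simp only [Subgroup.map_commutator] at *
  exact Subgroup.commutator_commutator_eq_bot_of_rotate h1 h2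

theorem commutator_lowerCentralSeries_le {G : Type*} [Group G] (m n : ℕ) :
    ⁅(⊤ : Subgroup G).lowerCentralSeries m, (⊤ : Subgroup G).lowerCentralSeries n⁆ ≤
      (⊤ : Subgroup G).lowerCentralSeries (m + n + 1) := by
  induction n generalizing m with
  | zero => exact le_rfl
  | succ n ih =>
    rw [Subgroup.commutator_comm, Subgroup.lowerCentralSeries_succ]
    apply commutator_commutator_le_of_rotate
    · rw [Subgroup.commutator_comm (⊤ : Subgroup G), ← Subgroup.lowerCentralSeries_succ]
      exact (ih (m + 1)).trans (le_of_eq (by congr 1; omega))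
    · exact (Subgroup.commutator_mono (ih m) le_rfl)

/-! ### Polynomial sequences in filtered groups -/

/-- `f` is a polynomial sequence with respect to `F` starting in `F i`, tested on its first `m`
successive differences. -/
def IsPolySeq {G : Type*} [Group G] (F : ℕ → Subgroup G) : ℕ → ℕ → (ℕ → G) → Prop
  | 0, i, f => ∀ n, f n ∈ F i
  | m + 1, i, f => (∀ n, f n ∈ F i) ∧ IsPolySeq F m (i + 1) fun n => (f n)⁻¹ * f (n + 1)

namespace IsPolySeq

variable {G : Type*} [Group G] {F : ℕ → Subgroup G}

theorem mem {m i : ℕ} {f : ℕ → G} (h : IsPolySeq F m i f) (n : ℕ) : f n ∈ F i := by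
  cases m with
  | zero => exact h n
  | succ m => exact h.1 n

theorem of_succ {m i : ℕ} {f : ℕ → G} (h : IsPolySeq F (m + 1) i f) : IsPolySeq F m i f := by
  induction m generalizing i f with
  | zero => exact h.1
  | succ m ih => exact ⟨h.1, ih h.2⟩

theorem anti (hF : Antitone F) {m i j : ℕ} (hij : i ≤ j) {f : ℕ → G} (h : IsPolySeq F m j f) :
    IsPolySeq F m i f := by
  induction m generalizing i j f with
  | zero => exact fun n => hF hij (h n)
  | succ m ih => exact ⟨fun n => hF hij (h.1 n), ih (Nat.succ_le_succ hij) h.2⟩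

theorem one (m i : ℕ) : IsPolySeq F m i fun _ => 1 := by
  induction m generalizing i with
  | zero => exact fun n => one_mem _
  | succ m ih => exact ⟨fun n => one_mem _, by simpa using ih (i + 1)⟩

/-- The Lazard–Leibman theorem: polynomial sequences form a filtration of subgroups. -/
theorem exists_subgroup (hF : Antitone F) (hc : ∀ i j, ⁅F i, F j⁆ ≤ F (i + j)) (m : ℕ) :
    ∃ P : ℕ → Subgroup (ℕ → G), (∀ i f, f ∈ P i ↔ IsPolySeq F m i f) ∧
      ∀ i j, ⁅P i, P j⁆ ≤ P (i + j) := by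
  induction m with
  | zero =>
    refine ⟨fun i => Subgroup.pi Set.univ fun _ => F i, fun i f => ?_, fun i j => ?_⟩
    · simp [Subgroup.mem_pi, IsPolySeq]
    · rw [Subgroup.commutator_le]
      intro f hf g hg n hn
      exact hc i j (Subgroup.commutator_mem_commutator (hf n hn) (hg n hn))
  | succ m ih =>
    -- Both claims go through one induction: closure under products at depth `m + 1` needs the
    -- commutator bound at depth `m`, through conjugation.
    obtain ⟨P, hP, hPc⟩ := ih
    have hPa : Antitone P := fun i j hij f hf => (hP i f).2 (((hP j f).1 hf).anti hF hij)
    have hcomm : ∀ {i j k f g}, f ∈ P i → g ∈ P j → k ≤ i + j → ⁅f, g⁆ ∈ P k :=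
      fun hf hg hk => hPa hk (hPc _ _ (Subgroup.commutator_mem_commutator hf hg))
    have hconj : ∀ {k f g}, f ∈ P 0 → g ∈ P k → f * g * f⁻¹ ∈ P k := fun {k f g} hf hg => by
      have : f * g * f⁻¹ = ⁅f, g⁆ * g := by simp [commutatorElement_def]
      rw [this]
      exact mul_mem (hcomm hf hg (by omega)) hg
    have step : ∀ i f, IsPolySeq F (m + 1) i f ↔
        (∀ n, f n ∈ F i) ∧ f⁻¹ * (fun n => f (n + 1)) ∈ P (i + 1) := fun i f => by
      rw [hP]; rfl
    have low : ∀ {i f}, IsPolySeq F (m + 1) i f → f ∈ P i := fun h => (hP _ _).2 h.of_succ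
    refine ⟨fun i =>
      { carrier := {f | IsPolySeq F (m + 1) i f}
        one_mem' := one _ _
        mul_mem' := ?_
        inv_mem' := ?_ }, fun i f => Iff.rfl, fun i j => ?_⟩
    · intro f g hf hg
      have hg' := low hg
      have ha := ((step i f).1 hf).2
      have hb := ((step i g).1 hg).2
      refine (step i _).2 ⟨fun n => mul_mem (hf.mem n) (hg.mem n), ?_⟩
      have : (f * g)⁻¹ * (fun n => (f * g) (n + 1)) =
          (g⁻¹ * (f⁻¹ * fun n => f (n + 1)) * g⁻¹⁻¹) * (g⁻¹ * fun n => g (n + 1)) := by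
        ext n; simp [mul_assoc]
      rw [this]
      exact mul_mem (hconj (inv_mem (hPa (Nat.zero_le _) hg')) ha) hb
    · intro f hf
      have ha := ((step i f).1 hf).2
      refine (step i _).2 ⟨fun n => inv_mem (hf.mem n), ?_⟩
      have : (f⁻¹)⁻¹ * (fun n => f⁻¹ (n + 1)) = f * (f⁻¹ * fun n => f (n + 1))⁻¹ * f⁻¹ := by
        ext n; simp [mul_assoc]
      rw [this]
      exact hconj (hPa (Nat.zero_le _) (low hf)) (inv_mem ha)
    · rw [Subgroup.commutator_le]
      intro f hf g hg
      have ha := ((step i f).1 hf).2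
      have hb := ((step j g).1 hg).2
      have hf0 := hPa (Nat.zero_le _) (low hf)
      have hg0 := hPa (Nat.zero_le _) (low hg)
      refine (step _ _).2 ⟨fun n =>
        hc i j (Subgroup.commutator_mem_commutator (hf.mem n) (hg.mem n)), ?_⟩
      have hg1 : (fun n => g (n + 1)) ∈ P j := by
        have := mul_mem (low hg) (hPa (Nat.le_succ _) hb)
        rwa [mul_inv_cancel_left] at this
      have : ⁅f, g⁆⁻¹ * (fun n => ⁅f, g⁆ (n + 1)) =
          (⁅f, g⁆⁻¹ * (f * ⁅f⁻¹ * (fun n => f (n + 1)), fun n => g (n + 1)⁆ * f⁻¹) * ⁅f, g⁆⁻¹⁻¹) *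
            (g * ⁅f, g⁻¹ * fun n => g (n + 1)⁆ * g⁻¹) := by
        ext n; simp [commutatorElement_def, mul_assoc]
      rw [this]
      have hc0 : ⁅f, g⁆ ∈ P 0 := hcomm hf0 hg0 (by omega)
      exact mul_mem (hconj (inv_mem hc0) (hconj hf0 (hcomm ha hg1 (by omega))))
        (hconj hg0 (hcomm (low hf) hb (by omega)))

theorem mul (hF : Antitone F) (hc : ∀ i j, ⁅F i, F j⁆ ≤ F (i + j)) {m i : ℕ} {f g : ℕ → G}
    (hf : IsPolySeq F m i f) (hg : IsPolySeq F m i g) : IsPolySeq F m i fun n => f n * g n := by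
  obtain ⟨P, hP, -⟩ := exists_subgroup hF hc m
  exact (hP _ _).1 (mul_mem ((hP _ _).2 hf) ((hP _ _).2 hg))

/-- By Pascal's rule, differencing lowers the binomial degree by one and raises the filtration level
by one. -/
theorem pow_choose (hF : Antitone F) (m : ℕ) {i k : ℕ} {c : G} (h : c ∈ F (i + k)) :
    IsPolySeq F m i fun n => c ^ n.choose k := by
  induction m generalizing i k with
  | zero => exact fun n => pow_mem (hF (Nat.le_add_right _ _) h) _
  | succ m ih =>
    refine ⟨fun n => pow_mem (hF (Nat.le_add_right _ _) h) _, ?_⟩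
    cases k with
    | zero => simpa using one m (i + 1)
    | succ k =>
      have := ih (i := i + 1) (k := k) (by rwa [add_right_comm])
      convert this using 2 with n
      beta_reduce
      rw [Nat.choose_succ_succ', Nat.add_comm (n.choose k), pow_add, inv_mul_cancel_left]

/-- Differencing keeps the first possibly nontrivial value and moves it one place to the left, so `f
m` is the initial value of the `m`-th difference. -/
theorem mem_of_vanish {m i : ℕ} {f : ℕ → G} (h : IsPolySeq F m i f) (h1 : ∀ n < m, f n = 1) :
    f m ∈ F (i + m) := by
  induction m generalizing i f with
  | zero => exact h 0
  | succ m ih =>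
    have := ih h.2 fun n hn => by rw [h1 n (by omega), h1 (n + 1) (by omega)]; simp
    rw [h1 m (by omega)] at this
    rw [show i + (m + 1) = i + 1 + m by omega]
    simpa using this

/-- Taylor coefficients are stripped off one degree at a time. Each is a value of the sequence,
hence in `N`, so its `p.choose k`-th power is trivial and the value at `p` never changes. -/
theorem apply_prime_eq_one (hF : Antitone F) (hc : ∀ i j, ⁅F i, F j⁆ ≤ F (i + j)) {p : ℕ}
    (hp : p.Prime) (hFp : F p = ⊥) {N : Subgroup G} (hN : ∀ x ∈ N, x ^ p = 1) {f : ℕ → G}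
    (hf : ∀ m, IsPolySeq F m 0 f) (hfN : ∀ n, f n ∈ N) (hf0 : f 0 = 1) : f p = 1 := by
  have key : ∀ k, k < p → ∃ g : ℕ → G, (∀ m, IsPolySeq F m 0 g) ∧ (∀ n, g n ∈ N) ∧
      (∀ n < k + 1, g n = 1) ∧ g p = f p := by
    intro k
    induction k with
    | zero => exact fun _ => ⟨f, hf, hfN, by simpa using hf0, rfl⟩
    | succ k ih =>
      intro hk
      obtain ⟨g, hg, hgN, hg1, hgp⟩ := ih (by omega)
      have hmem : (g (k + 1))⁻¹ ∈ F (0 + (k + 1)) := inv_mem ((hg _).mem_of_vanish hg1)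
      refine ⟨fun n => g n * (g (k + 1))⁻¹ ^ n.choose (k + 1),
        fun m => (hg m).mul hF hc (pow_choose hF m hmem),
        fun n => mul_mem (hgN n) (pow_mem (inv_mem (hgN _)) _), fun n hn => ?_, ?_⟩
      · rcases Nat.lt_succ_iff_lt_or_eq.1 hn with h | rfl
        · simp [hg1 n h, Nat.choose_eq_zero_of_lt h]
        · simp
      · obtain ⟨d, hd⟩ := hp.dvd_choose_self (Nat.succ_ne_zero k) hk
        simp [hd, pow_mul, hN _ (hgN _), hgp]
  obtain ⟨g, hg, -, hg1, hgp⟩ := key (p - 1) (by have := hp.pos; omega)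
  rw [Nat.sub_add_cancel hp.one_le] at hg1
  have := (hg p).mem_of_vanish hg1
  rw [zero_add, hFp, Subgroup.mem_bot, hgp] at this
  exact this

end IsPolySeq

/-- In a group of class less than `p`, multiplying by an element of a normal subgroup of
exponent `p` does not change `p`-th powers. -/
theorem mul_pow_prime_of_lowerCentralSeries_eq_bot {K : Type*} [Group K] {p : ℕ} (hp : p.Prime)
    (hK : (⊤ : Subgroup K).lowerCentralSeries (p - 1) = ⊥) {N : Subgroup K} [N.Normal]
    (hN : ∀ x ∈ N, x ^ p = 1) {y : K} (hy : y ∈ N) (a : K) : (y * a) ^ p = a ^ p := by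
  -- The truncated subtraction gives `F 0 = F 1 = ⊤`, so linear sequences `c ^ n` are polynomial
  -- from level `0`.
  let F : ℕ → Subgroup K := fun i => (⊤ : Subgroup K).lowerCentralSeries (i - 1)
  have hF : Antitone F := fun i j hij =>
    Subgroup.lowerCentralSeries_antitone _ (Nat.sub_le_sub_right hij 1)
  have hc : ∀ i j, ⁅F i, F j⁆ ≤ F (i + j) := fun i j =>
    (commutator_lowerCentralSeries_le _ _).trans
      (Subgroup.lowerCentralSeries_antitone _ (by omega))
  have htop : ∀ c, c ∈ F (0 + 1) := fun c => Subgroup.mem_top c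
  have := IsPolySeq.apply_prime_eq_one hF hc hp hK hN
    (f := fun n => (y * a) ^ n.choose 1 * a⁻¹ ^ n.choose 1)
    (fun m => (IsPolySeq.pow_choose hF m (htop _)).mul hF hc (IsPolySeq.pow_choose hF m (htop _)))
    (fun n => ?_) (by simp)
  · simpa [mul_inv_eq_one] using this
  · rw [← QuotientGroup.eq_one_iff]
    have : (y : K ⧸ N) = 1 := (QuotientGroup.eq_one_iff y).2 hy
    simp [this]

/-! ### Normal subgroups of finite `p`-groups -/

theorem commutator_top_lt_of_isNilpotent {H : Type*} [Group H] [Group.IsNilpotent H]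
    {M : Subgroup H} [M.Normal] (hM : M ≠ ⊥) : ⁅M, (⊤ : Subgroup H)⁆ < M := by
  refine lt_of_le_of_ne (Subgroup.commutator_le_left M ⊤) fun h => hM ?_
  obtain ⟨n, hn⟩ := Subgroup.nilpotent_iff_lowerCentralSeries.1 ‹Group.IsNilpotent H›
  have key : ∀ n, M ≤ (⊤ : Subgroup H).lowerCentralSeries n := fun n => by
    induction n with
    | zero => exact le_top
    | succ n ih => rw [← h]; exact Subgroup.commutator_mono ih le_rfl
  exact le_bot_iff.1 (hn ▸ key n)

/-- The iterated commutators `[N, H, …, H]`. -/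
def relLowerCentralSeries {H : Type*} [Group H] (N : Subgroup H) : ℕ → Subgroup H
  | 0 => N
  | i + 1 => ⁅relLowerCentralSeries N i, ⊤⁆

section relLowerCentralSeries

variable {H : Type*} [Group H] (N : Subgroup H) [N.Normal]

instance relLowerCentralSeries_normal (i : ℕ) : (relLowerCentralSeries N i).Normal := by
  induction i with
  | zero => assumption
  | succ i ih => exact Subgroup.commutator_normal _ _

/-- By nilpotency every step from a nontrivial term is strict, hence of index at least `p`. -/
theorem relLowerCentralSeries_eq_bot_or_card_mul_pow_le [Finite H] {p : ℕ} [Fact p.Prime]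
    (hH : IsPGroup p H) (i : ℕ) : relLowerCentralSeries N i = ⊥ ∨
      Nat.card (relLowerCentralSeries N i) * p ^ i ≤ Nat.card N := by
  have := hH.isNilpotent
  induction i with
  | zero => exact Or.inr (by simp [relLowerCentralSeries])
  | succ i ih =>
    by_cases hb : relLowerCentralSeries N i = ⊥
    · left; rw [relLowerCentralSeries, hb, Subgroup.commutator_bot_left]
    · right
      have hlt := commutator_top_lt_of_isNilpotent hb
      refine le_trans ?_ (ih.resolve_left hb)
      rw [relLowerCentralSeries, pow_succ', ← mul_assoc]
      refine Nat.mul_le_mul_right _ ?_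
      set A := ⁅relLowerCentralSeries N i, (⊤ : Subgroup H)⁆
      set B := relLowerCentralSeries N i
      have hidx : A.relIndex B ≠ 1 := fun h => hlt.not_ge (Subgroup.relIndex_eq_one.1 h)
      obtain ⟨k, hk⟩ := (hH.to_subgroup B).index (A.subgroupOf B)
      change A.relIndex B = p ^ k at hk
      have hk0 : k ≠ 0 := by rintro rfl; exact hidx (by simpa using hk)
      have hcard : Nat.card A * A.relIndex B = Nat.card B := by
        rw [← Subgroup.relIndex_bot_left, ← Subgroup.relIndex_bot_left]
        exact Subgroup.relIndex_mul_relIndex _ _ _ bot_le hlt.le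
      rw [← hcard, hk]
      exact Nat.mul_le_mul_left _ (Nat.le_self_pow hk0 p)

theorem relLowerCentralSeries_eq_bot [Finite H] {p : ℕ} [hp : Fact p.Prime]
    (hH : IsPGroup p H) (hN : Nat.card N ≤ p ^ p) : relLowerCentralSeries N p = ⊥ := by
  rcases relLowerCentralSeries_eq_bot_or_card_mul_pow_le N hH p with h | h
  · exact h
  · refine Subgroup.card_eq_one.1 (le_antisymm ?_ Nat.card_pos)
    exact Nat.le_of_mul_le_mul_right (by simpa using h.trans hN) (pow_pos hp.out.pos p)

/-- Modulo `[N, H]` the subgroup `N` is central, so `N⟨a⟩` becomes a central subgroup times a cyclic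
one, which is abelian. -/
theorem commutator_sup_zpowers_le (a : H) :
    ⁅N ⊔ Subgroup.zpowers a, N ⊔ Subgroup.zpowers a⁆ ≤ ⁅N, (⊤ : Subgroup H)⁆ := by
  let φ := QuotientGroup.mk' ⁅N, (⊤ : Subgroup H)⁆
  have hcen : ∀ n ∈ N, ∀ h, Commute (φ n) (φ h) := fun n hn h => by
    rw [← commutatorElement_eq_one_iff_commute, ← map_commutatorElement]
    exact (QuotientGroup.eq_one_iff _).2
      (Subgroup.commutator_mem_commutator hn (Subgroup.mem_top h))
  rw [Subgroup.commutator_le]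
  intro x hx y hy
  obtain ⟨m, hm, z, hz, rfl⟩ := Subgroup.mem_sup_of_normal_left.1 hx
  obtain ⟨n, hn, w, hw, rfl⟩ := Subgroup.mem_sup_of_normal_left.1 hy
  obtain ⟨i, rfl⟩ := Subgroup.mem_zpowers_iff.1 hz
  obtain ⟨j, rfl⟩ := Subgroup.mem_zpowers_iff.1 hw
  rw [← QuotientGroup.eq_one_iff]
  change φ _ = 1
  rw [map_commutatorElement, commutatorElement_eq_one_iff_commute, map_mul φ m]
  refine (hcen m hm _).mul_left ?_
  rw [map_mul]
  refine ((hcen n hn _).symm).mul_right ?_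
  rw [map_zpow, map_zpow]
  exact (Commute.refl _).zpow_zpow i j

theorem lowerCentralSeries_sup_zpowers_le (a : H) (n : ℕ) :
    (relLowerCentralSeries N 1 ⊔ Subgroup.zpowers a).lowerCentralSeries (n + 1) ≤
      relLowerCentralSeries N (n + 2) := by
  induction n with
  | zero => exact commutator_sup_zpowers_le _ a
  | succ n ih => exact Subgroup.commutator_mono ih le_top

/-- In a finite `p`-group, `p`-th powers centralize every normal subgroup of exponent `p` and
order at most `p ^ p`. -/
theorem commute_pow_prime_of_card_le [Finite H] {p : ℕ} [hp : Fact p.Prime] (hH : IsPGroup p H)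
    (hN : Nat.card N ≤ p ^ p) (hexp : ∀ x ∈ N, x ^ p = 1) (a : H) {x : H} (hx : x ∈ N) :
    Commute x (a ^ p) := by
  -- Using `[N, H]` rather than `N` gains the one step that brings the class of `S` below `p`.
  set M := relLowerCentralSeries N 1
  set S := M ⊔ Subgroup.zpowers a
  have hMN : M ≤ N := Subgroup.commutator_le_left N ⊤
  have hS : S.lowerCentralSeries (p - 1) = ⊥ := by
    have h2 := hp.out.two_le
    have := lowerCentralSeries_sup_zpowers_le N a (p - 2)
    rw [show p - 2 + 1 = p - 1 by omega, show p - 2 + 2 = p by omega,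
      relLowerCentralSeries_eq_bot N hH hN] at this
    exact le_bot_iff.1 this
  have hS' : (⊤ : Subgroup S).lowerCentralSeries (p - 1) = ⊥ := by
    rw [← Subgroup.map_subtype_inj, Subgroup.map_bot, Subgroup.top_subtype_lowerCentralSeries, hS]
  have hy : ⁅x, a⁆ ∈ M := Subgroup.commutator_mem_commutator hx (Subgroup.mem_top a)
  have haS : a ∈ S := Subgroup.mem_sup_right (Subgroup.mem_zpowers a)
  have key := mul_pow_prime_of_lowerCentralSeries_eq_bot hp.out hS' (N := M.subgroupOf S)
    (fun z hz => Subtype.ext (hexp _ (hMN hz)))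
    (y := ⟨⁅x, a⁆, Subgroup.mem_sup_left hy⟩) hy ⟨a, haS⟩
  have key' : (⁅x, a⁆ * a) ^ p = a ^ p := congrArg Subtype.val key
  rw [← conj_eq_commutatorElement_mul, MulAut.conj_apply, conj_pow, mul_inv_eq_iff_eq_mul] at key'
  exact key'

end relLowerCentralSeries

/-! ### Automorphisms of `p`-power order -/

theorem mulAut_pow_prime_eq_one {G : Type*} [Group G] [Finite G] {p : ℕ} [hp : Fact p.Prime]
    (hcard : Nat.card G ≤ p ^ p) (hexp : ∀ x : G, x ^ p = 1) {α : MulAut G} {k : ℕ}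
    (hα : α ^ p ^ k = 1) : α ^ p = 1 := by
  let Z := Subgroup.zpowers α
  let H := G ⋊[Z.subtype] Z
  have hG : IsPGroup p G := fun x => ⟨1, by simpa using hexp x⟩
  have hZ : IsPGroup p Z := by
    rw [IsPGroup.iff_card]
    obtain ⟨j, -, hj⟩ := (Nat.dvd_prime_pow hp.out).1 (orderOf_dvd_of_pow_eq_one hα)
    exact ⟨j, by rw [Nat.card_zpowers, hj]⟩
  have hfin : Finite H := Finite.of_equiv _ SemidirectProduct.equivProd.symm
  have hH : IsPGroup p H := by
    obtain ⟨m, hm⟩ := IsPGroup.iff_card.1 hG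
    obtain ⟨n, hn⟩ := IsPGroup.iff_card.1 hZ
    refine IsPGroup.of_card (n := m + n) ?_
    rw [SemidirectProduct.card, hm, hn, pow_add]
  let N : Subgroup H := (SemidirectProduct.inl : G →* H).range
  have hNn : N.Normal := by
    change (SemidirectProduct.inl : G →* H).range.Normal
    rw [SemidirectProduct.range_inl_eq_ker_rightHom]; infer_instance
  have hNc : Nat.card N ≤ p ^ p := by
    rwa [← Nat.card_congr
      (MonoidHom.ofInjective (f := (SemidirectProduct.inl : G →* H))
        SemidirectProduct.inl_injective).toEquiv]
  have hNe : ∀ x ∈ N, x ^ p = 1 := by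
    rintro _ ⟨x, rfl⟩
    rw [← map_pow, hexp, map_one]
  let a : Z := ⟨α, Subgroup.mem_zpowers α⟩
  ext x
  have hcomm := commute_pow_prime_of_card_le N hH hNc hNe (SemidirectProduct.inr a)
    (x := SemidirectProduct.inl x) ⟨x, rfl⟩
  have h1 := SemidirectProduct.inl_aut (φ := Z.subtype) (a ^ p) x
  rw [map_inv, map_pow, map_pow, ← hcomm.eq, mul_inv_cancel_right, SemidirectProduct.inl_inj] at h1
  simpa [a] using h1

/-- A nontrivial homomorphism `φ` of exponent `p` from a group to a central subgroup of its kernel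
yields the automorphism `x ↦ x * φ x` of order `p`. -/
theorem exists_mulAut_pow_eq_one_of_hom {G : Type*} [Group G] {p : ℕ} (φ : G →* G)
    (hφc : ∀ x y, Commute (φ x) y) (hφφ : ∀ x, φ (φ x) = 1) (hφp : ∀ x, φ x ^ p = 1)
    (hφ : φ ≠ 1) : ∃ α : MulAut G, α ≠ 1 ∧ α ^ p = 1 := by
  let α : MulAut G :=
    { toFun := fun x => x * φ x
      invFun := fun x => x * (φ x)⁻¹
      left_inv := fun x => by simp [hφφ]
      right_inv := fun x => by simp [hφφ]
      map_mul' := fun x y => by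
        rw [map_mul, mul_assoc x y, mul_assoc x (φ x), (hφc x (y * φ y)).eq, mul_assoc y,
          (hφc x (φ y)).eq] }
  have hpow : ∀ n x, (α ^ n) x = x * φ x ^ n := fun n x => by
    induction n with
    | zero => simp
    | succ n ih =>
      rw [pow_succ', MulAut.mul_apply, ih]
      change x * φ x ^ n * φ (x * φ x ^ n) = _
      simp [hφφ, pow_succ, mul_assoc]
  refine ⟨α, fun h => hφ ?_, ?_⟩
  · ext x
    simpa [α] using DFunLike.congr_fun h x
  · ext x
    simp [hpow, hφp]

theorem exists_mulAut_pow_prime_eq_one {G : Type*} [Group G] [Finite G] {p : ℕ}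
    [hp : Fact p.Prime] (hG : ¬ IsCyclic G) (hexp : ∀ x : G, x ^ p = 1) :
    ∃ α : MulAut G, α ≠ 1 ∧ α ^ p = 1 := by
  by_cases hab : ∀ x y : G, Commute x y
  · have hPG : IsPGroup p G := fun x => ⟨1, by simpa using hexp x⟩
    obtain ⟨n, hn⟩ := IsPGroup.iff_card.1 hPG
    have hn2 : 2 ≤ n := by
      by_contra! h
      apply hG
      interval_cases n
      · have := (Nat.card_eq_one_iff_unique.1 (hn.trans (pow_zero p))).1
        infer_instance
      · exact isCyclic_of_prime_card (hn.trans (pow_one p))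
    obtain ⟨M, hM⟩ := Sylow.exists_subgroup_card_pow_prime (G := G) p (n := n - 1)
      (hn ▸ pow_dvd_pow p (Nat.sub_le n 1))
    have hMn : M.Normal := ⟨fun m hm g => by
      rwa [(hab g m).eq, mul_inv_cancel_right]⟩
    have hMi : Nat.card (G ⧸ M) = p := by
      have := M.card_eq_card_quotient_mul_card_subgroup
      rw [hn, hM, ← Nat.sub_add_cancel (show 1 ≤ n by omega), pow_succ', Nat.add_sub_cancel] at this
      exact (Nat.eq_of_mul_eq_mul_right (pow_pos hp.out.pos _) this).symm
    have hMb : M ≠ ⊥ := by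
      rintro rfl
      rw [Subgroup.card_bot] at hM
      have := Nat.one_lt_pow (show n - 1 ≠ 0 by omega) hp.out.one_lt
      omega
    obtain ⟨z, hzM, hz1⟩ := M.bot_or_exists_ne_one.resolve_left hMb
    have hzo : orderOf z = p := orderOf_eq_prime (hexp z) hz1
    have : IsCyclic (G ⧸ M) := isCyclic_of_prime_card hMi
    -- As `z` lies in the index-`p` subgroup `M`, the resulting endomorphism `φ` kills its own
    -- image.
    let e : G ⧸ M ≃* Subgroup.zpowers z :=
      mulEquivOfCyclicCardEq (by rw [hMi, Nat.card_zpowers, hzo])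
    let φ : G →* G := (Subgroup.zpowers z).subtype.comp
      (e.toMonoidHom.comp (QuotientGroup.mk' M))
    refine exists_mulAut_pow_eq_one_of_hom φ (fun x y => hab _ _) (fun x => ?_)
      (fun x => hexp _) fun h => ?_
    · have hx : φ x ∈ M := (Subgroup.zpowers_le.2 hzM) (e (QuotientGroup.mk' M x)).2
      have : QuotientGroup.mk' M (φ x) = 1 := (QuotientGroup.eq_one_iff _).2 hx
      change ((e (QuotientGroup.mk' M (φ x)) : Subgroup.zpowers z) : G) = 1
      rw [this, map_one]; rfl
    · obtain ⟨q, hq⟩ := e.surjective ⟨z, Subgroup.mem_zpowers z⟩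
      obtain ⟨g, rfl⟩ := QuotientGroup.mk'_surjective M q
      apply hz1
      have : φ g = z := congrArg Subtype.val hq
      rw [← this, h]; rfl
  · push Not at hab
    obtain ⟨x, y, hxy⟩ := hab
    refine ⟨MulAut.conj x, fun h => hxy ?_, by rw [← map_pow, hexp, map_one]⟩
    have := DFunLike.congr_fun h y
    rw [MulAut.conj_apply, MulAut.one_apply, mul_inv_eq_iff_eq_mul] at this
    exact this

theorem exponent_sylow_mulAut_eq_prime {p : ℕ} (hp : p.Prime) (G : Type*) [Group G] [Finite G]
    (hG : ¬ IsCyclic G) (hcard : Nat.card G ≤ p ^ p) (hexp : Monoid.exponent G = p)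
    (P : Sylow p (MulAut G)) : Monoid.exponent P = p := by
  have := Fact.mk hp
  have hexp' : ∀ x : G, x ^ p = 1 := fun x => hexp ▸ Monoid.pow_exponent_eq_one x
  have hdvd : Monoid.exponent P ∣ p := Monoid.exponent_dvd_of_forall_pow_eq_one fun α => by
    obtain ⟨k, hk⟩ := P.isPGroup' α
    exact Subtype.ext (mulAut_pow_prime_eq_one hcard hexp' (congrArg Subtype.val hk))
  refine ((Nat.dvd_prime hp).1 hdvd).resolve_left fun h1 => ?_
  obtain ⟨α, hα1, hαp⟩ := exists_mulAut_pow_prime_eq_one hG hexp'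
  have hpc : p ∣ Nat.card (MulAut G) :=
    (orderOf_eq_prime hαp hα1) ▸ orderOf_dvd_natCard α
  have hPs : Subsingleton P := Monoid.exp_eq_one_iff.1 h1
  exact P.ne_bot_of_dvd_card hpc ((Subgroup.eq_bot_iff_forall _).2 fun x hx =>
    congrArg Subtype.val (Subsingleton.elim (⟨x, hx⟩ : P) 1))

/-- Some element has order the full `p`-part of the exponent, and it lies in a Sylow `p`-subgroup.
-/
theorem not_sq_dvd_exponent_of_sylow {A : Type*} [Group A] [Finite A] {p : ℕ} (hp : p.Prime)
    (h : ∀ P : Sylow p A, Monoid.exponent P = p) : ¬ p ^ 2 ∣ Monoid.exponent A := by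
  have := Fact.mk hp
  intro hd
  obtain ⟨a, ha⟩ := hp.exists_orderOf_eq_pow_factorization_exponent A
  have h2 := (hp.pow_dvd_iff_le_factorization Monoid.exponent_ne_zero_of_finite).1 hd
  have hz : IsPGroup p (Subgroup.zpowers a) :=
    IsPGroup.of_card (by rw [Nat.card_zpowers, ha])
  obtain ⟨P, hP⟩ := hz.exists_le_sylow
  have hap : a ^ p = 1 := congrArg Subtype.val
    (Monoid.exponent_dvd_iff_forall_pow_eq_one.1 (h P).dvd ⟨a, hP (Subgroup.mem_zpowers a)⟩)
  have hle := (Nat.pow_dvd_pow_iff_le_right hp.one_lt).1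
    ((pow_dvd_pow p h2).trans (ha ▸ (orderOf_dvd_of_pow_eq_one hap).trans (pow_one p).symm.dvd))
  omega

theorem mainTheorem3 :
    (∀ (p : ℕ), p.Prime → ∀ (G : Type u) [Group G] [Finite G],
      ¬ IsCyclic G → Nat.card G ≤ p ^ p → Monoid.exponent G = p →
        ∀ P : Sylow p (MulAut G), Monoid.exponent P = p) ∧
    ¬ ∃ (p : ℕ) (G : Type u) (_ : Group G),
      p.Prime ∧ Nat.card G = p ^ p ∧ Monoid.exponent G = p ∧
        p ^ 2 ∣ Monoid.exponent (MulAut G) := by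
  refine ⟨fun p hp G _ _ hG hcard hexp P => exponent_sylow_mulAut_eq_prime hp G hG hcard hexp P, ?_⟩
  rintro ⟨p, G, _, hp, hcard, hexp, hd⟩
  have : Finite G := Nat.finite_of_card_ne_zero (hcard ▸ (pow_pos hp.pos p).ne')
  refine not_sq_dvd_exponent_of_sylow hp
    (exponent_sylow_mulAut_eq_prime hp G (fun hc => ?_) hcard.le hexp) hd
  -- A cyclic `G` would force `p = p ^ p`.
  have := IsCyclic.exponent_eq_card (α := G)
  rw [hexp, hcard] at this
  exact (Nat.lt_pow_self hp.one_lt).ne this
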